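/- Let $\lambda_x\ge 0$ ($x\in\mathbb N=\{0,1,2,\dots\}$) be birth rates and $\nu_x\ge 0$ death rates with $\nu_0=0$. For $y\in\mathbb N$, a birth-death process $(X^y_t)_{t\ge0}$ with these rates started at $y$ is an $\mathbb N$-valued Markov process with $X^y_0=y$ almost surely and with a transition semigroup of Markov kernels $(P_t)_{t\ge0}$ on $\mathbb N$ such that, as $t\to0^+$, $P_t(x,\{x+1\})=\lambda_xt+o(t)$, $P_t(x,\{x-1\})=\nu_xt+o(t)$ (for $x\ge1$) and $P_t(x,\{x\})=1-(\lambda_x+\nu_x)t+o(t)$ for every $x\in\mathbb N$. For $\mathbb N$-valued random variables $X,Y$, write $X\le_{c}Y$ ($X$ is convex dominated by $Y$) if $\mathbb E[f(X)]\le\mathbb E[f(Y)]$ in $[0,\infty]$ for every non-negative non-decreasing $f:\mathbb N\to\mathbb R$ with $f(x+2)-2f(x+1)+f(x)\ge0$ for all $x\in\mathbb N$. Suppose that $\lambda$ is non-increasing and that there is $\kappa\ge0$ such that $(\nu_{x+1}-\lambda_{x+1})-(\nu_x-\lambda_x)\ge\kappa$ for all $x\in\mathbb N$. Then for every $t\ge0$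 and every $x\in\mathbb N$: (1) $X_t^{x+1}\le_{c}X_t^x+Y_t$, where $Y_t$ is a Bernoulli random variable with parameter $e^{-\kappa t}$ independent of $X_t^x$; (2) $X_t^{x}\le_{c}X_t^0+B_t^{(x)}$, where $B_t^{(x)}$ is a binomial random variable with parameters $(x,e^{-\kappa t})$ independent of $X_t^0$. -/

import Mathlib

open MeasureTheory ProbabilityTheory Filter Topology Asymptotics
open scoped NNReal ENNReal

namespace BirthDeath

/-- `P` is the (Markov) transition semigroup on `ℕ` of a birth-death process with birth rates `lam`
and death rates `nu`: as `t → 0+`,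
`P t x {x + 1} = lam x * t + o(t)`, `P t x {x - 1} = nu x * t + o(t)` for `x ≥ 1`, and
`P t x {x} = 1 - (lam x + nu x) * t + o(t)`.
(The case `x ≥ 1` is written with `x + 1` in place of `x`.) -/
structure IsTransitionSemigroup (lam nu : ℕ → ℝ) (P : ℝ≥0 → Kernel ℕ ℕ) : Prop where
  markov : ∀ t, IsMarkovKernel (P t)
  zero : P 0 = Kernel.id
  chapman_kolmogorov : ∀ s t, P (s + t) = P t ∘ₖ P s
  birth : ∀ x, (fun t : ℝ≥0 => (P t x).real {x + 1} - lam x * (t : ℝ))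
    =o[𝓝[>] 0] fun t : ℝ≥0 => (t : ℝ)
  death : ∀ x, (fun t : ℝ≥0 => (P t (x + 1)).real {x} - nu (x + 1) * (t : ℝ))
    =o[𝓝[>] 0] fun t : ℝ≥0 => (t : ℝ)
  stay : ∀ x, (fun t : ℝ≥0 => (P t x).real {x} - (1 - (lam x + nu x) * (t : ℝ)))
    =o[𝓝[>] 0] fun t : ℝ≥0 => (t : ℝ)

/-- The natural filtration of the process `X`: the σ-algebra generated by `X u`, `u ≤ s`. -/
abbrev past {Ω : Type*} (X : ℝ≥0 → Ω → ℕ) (s : ℝ≥0) : MeasurableSpace Ω :=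
  ⨆ u ∈ Set.Iic s, MeasurableSpace.comap (X u) ⊤

/-- Under the probability measure `μ`, the `ℕ`-valued process `X` is a birth-death process with
birth rates `lam` and death rates `nu` starting at `y`: a Markov process, started at `y`, whose
transition semigroup is one of a birth-death process with these rates. -/
structure IsBirthDeathProcess {Ω : Type*} [MeasurableSpace Ω] (lam nu : ℕ → ℝ) (y : ℕ)
    (X : ℝ≥0 → Ω → ℕ) (μ : Measure Ω) : Prop where
  measurable : ∀ t, Measurable (X t)
  start : ∀ᵐ ω ∂μ, X 0 ω = y
  markov_property : ∃ P : ℝ≥0 → Kernel ℕ ℕ, IsTransitionSemigroup lam nu P ∧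
    ∀ (s t : ℝ≥0) (z : ℕ),
      μ⟦X (s + t) ⁻¹' {z} | past X s⟧ =ᵐ[μ] fun ω => (P t (X s ω)).real {z}

/-- The class of non-negative, non-decreasing, convex functions on `ℕ`, where convexity means that
the second forward difference is non-negative. -/
structure IsIncreasingConvex (f : ℕ → ℝ) : Prop where
  nonneg : ∀ x, 0 ≤ f x
  mono : Monotone f
  convex : ∀ x, 0 ≤ (f (x + 2) - f (x + 1)) - (f (x + 1) - f x)

/-- `X` (under `μ`) is convex dominated by `Y` (under `μ'`): `E[f(X)] ≤ E[f(Y)]` for every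
non-negative non-decreasing convex `f`; the expectations take values in `[0, ∞]`. -/
def ConvexDominated {Ω Ω' : Type*} [MeasurableSpace Ω] [MeasurableSpace Ω']
    (X : Ω → ℕ) (μ : Measure Ω) (Y : Ω' → ℕ) (μ' : Measure Ω') : Prop :=
  ∀ f : ℕ → ℝ, IsIncreasingConvex f →
    ∫⁻ ω, ENNReal.ofReal (f (X ω)) ∂μ ≤ ∫⁻ ω, ENNReal.ofReal (f (Y ω)) ∂μ'

/-- The parameter `exp (-κ t)`, as an element of the unit interval. -/
noncomputable def expParam (κ t : ℝ≥0) : unitInterval :=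
  ⟨Real.exp (-((κ : ℝ) * (t : ℝ))), (Real.exp_pos _).le,
    Real.exp_le_one_iff.2 (neg_nonpos.2 (by positivity))⟩

end BirthDeath

namespace BirthDeath

/-! The function `u = P_t f` solves the backward equation, and its discrete derivative `G` solves
the backward equation of a birth-death chain with birth rates `lam (x + 1)`, death rates `nu x` and
killing rate `V x`, the increment of `nu - lam`, which is at least `κ`. If `h` is non-negative,
non-decreasing and dominates the increments of `f`, then `exp (-κ t) P_t h` is a supersolution of
the equation for `G`: the excess `V - κ` and the drop of `lam` both have the right sign. Hence `G ≤
exp (-κ t) P_t h` (`act_succ_sub_le`), by the comparison principle `nonneg_of_supersolution`.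

For convex `f`, taking `h x = f (x + 1) - f x` after truncation gives `P_t f (x + 1) ≤ p P_t f(· +
1) (x) + (1 - p) P_t f (x)` with `p = exp (-κ t)`, which is the Bernoulli statement
(`lintegral_succ_le`). Iterating over the starting point, with `f` replaced by its shifts, gives the
binomial one. The same comparison principle shows that the semigroup is unique, so the two processes
share it. -/

/-- The generator of the birth-death process with birth rates `a` and death rates `d`. -/
def generator (a d : ℕ → ℝ) (f : ℕ → ℝ) (x : ℕ) : ℝ :=
  a x * (f (x + 1) - f x) + d x * (f (x - 1) - f x)

/-- The comparison principle: a supersolution, bounded below, of the equation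
`∂ₜ D = generator a d D - V D` that is non-negative at time `0` stays non-negative. -/
lemma nonneg_of_supersolution {a d V : ℕ → ℝ} {Λ C : ℝ} (ha0 : ∀ x, 0 ≤ a x) (ha : ∀ x, a x ≤ Λ)
    (hd : ∀ x, 0 ≤ d x) (hV : ∀ x, 0 ≤ V x) {D : ℝ → ℕ → ℝ}
    (hC : ∀ t, 0 ≤ t → ∀ x, -C ≤ D t x) (h0 : ∀ x, 0 ≤ D 0 x)
    (hcont : ∀ x, ContinuousOn (fun t => D t x) (Set.Ici 0))
    (hderiv : ∀ t, 0 ≤ t → ∀ x, ∃ D', HasDerivWithinAt (fun t => D t x) D' (Set.Ioi t) t ∧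
      generator a d (D t) x - V x * D t x ≤ D') {t : ℝ} (ht : 0 ≤ t) (x : ℕ) : 0 ≤ D t x := by
  have hΛ : 0 ≤ Λ := (ha0 0).trans (ha 0)
  have key : ∀ ε : ℝ, 0 < ε → 0 ≤ D t x + ε * (1 + x + (Λ + 1) * t) := by
    intro ε hε
    -- Growth in `x` confines possible negativity to finitely many sites. The slope `Λ + 1` in time
    -- beats the cost, at most `ε * Λ`, that this growth adds through births.
    let E : ℝ → ℕ → ℝ := fun t x => D t x + ε * (1 + x + (Λ + 1) * t)
    let s : Set ℝ := {t | ∀ x, 0 ≤ E t x}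
    have hEcont : ∀ x, ContinuousOn (fun t => E t x) (Set.Ici 0) := fun x =>
      (hcont x).add (by fun_prop)
    suffices h : Set.Icc 0 t ⊆ s from h ⟨ht, le_rfl⟩ x
    apply IsClosed.Icc_subset_of_forall_mem_nhdsWithin
    · have : s ∩ Set.Icc 0 t = ⋂ x, (Set.Icc 0 t ∩ (fun t => E t x) ⁻¹' Set.Ici 0) := by
        ext r
        simp only [s, Set.mem_inter_iff, Set.mem_ofPred_eq, Set.mem_iInter, Set.mem_preimage,
          Set.mem_Ici]
        exact ⟨fun h y => ⟨h.2, h.1 y⟩, fun h => ⟨fun y => (h y).2, (h 0).1⟩⟩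
      rw [this]
      exact isClosed_iInter fun x => ((hEcont x).mono Set.Icc_subset_Ici_self
        ).preimage_isClosed_of_isClosed isClosed_Icc isClosed_Ici
    · intro y
      have := h0 y
      simp only [E]
      positivity
    · rintro r ⟨hrs, hr0, -⟩
      obtain ⟨M, hM⟩ := exists_nat_ge (C / ε)
      rw [div_le_iff₀ hε] at hM
      have hfin : ∀ᶠ r' in 𝓝[>] r, ∀ y ∈ Finset.range M, 0 ≤ E r' y := by
        rw [Filter.eventually_all_finset]
        intro y _
        obtain ⟨D', hD', hle⟩ := hderiv r hr0 y
        have hE' : HasDerivWithinAt (fun t => E t y) (D' + ε * (Λ + 1)) (Set.Ioi r) r := by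
          have h1 : HasDerivWithinAt (fun t : ℝ => ε * (1 + (y : ℝ) + (Λ + 1) * t))
              (ε * ((Λ + 1) * 1)) (Set.Ioi r) r :=
            (((hasDerivWithinAt_id r _).const_mul (Λ + 1)).const_add _).const_mul ε
          rw [mul_one] at h1
          exact hD'.add h1
        -- A positive value persists by continuity; at a zero of `E`, which is a minimum over the
        -- sites, the right derivative is at least `ε`.
        rcases (hrs y).lt_or_eq with hpos | hzero
        · have := hE'.continuousWithinAt.eventually (lt_mem_nhds hpos)
          exact this.mono fun _ h => h.le
        · have hpos : 0 < D' + ε * (Λ + 1) := by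
            have hb := hrs (y + 1)
            have hdn := hrs (y - 1)
            simp only [E] at hzero hb hdn
            have h1 : -(ε * Λ) ≤ generator a d (D r) y - V y * D r y := by
              have e1 : -ε ≤ D r (y + 1) - D r y := by
                push_cast at hb; linarith
              have e2 : 0 ≤ D r (y - 1) - D r y := by
                rcases y with _ | y
                · simp
                · simp only [Nat.add_sub_cancel] at hdn ⊢
                  push_cast at hzero; nlinarith
              have e3 : D r y ≤ 0 := by
                have : 0 ≤ ε * (1 + (y : ℝ) + (Λ + 1) * r) := by positivity
                linarith
              have f1 := mul_le_mul_of_nonneg_left e1 (ha0 y)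
              have f2 := mul_nonneg (hd y) e2
              have f3 := mul_nonneg (hV y) (neg_nonneg.2 e3)
              have f4 := mul_le_mul_of_nonneg_left (ha y) hε.le
              simp only [generator]
              linarith
            linarith
          rw [hasDerivWithinAt_iff_tendsto_slope' (by simp)] at hE'
          filter_upwards [hE'.eventually (lt_mem_nhds hpos), self_mem_nhdsWithin] with r' h1 h2
          have h3 : 0 < r' - r := sub_pos.2 h2
          rw [slope_def_field, ← hzero, sub_zero] at h1
          exact ((div_pos_iff_of_pos_right h3).1 h1).le
      filter_upwards [hfin, self_mem_nhdsWithin] with r' h1 h2 y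
      have hr' : 0 ≤ r' := hr0.trans (le_of_lt h2)
      rcases lt_or_ge y M with hy | hy
      · exact h1 y (Finset.mem_range.2 hy)
      · have h3 := hC r' hr' y
        have h4 : (M : ℝ) ≤ y := by exact_mod_cast hy
        have h5 := mul_le_mul_of_nonneg_left h4 hε.le
        have h6 : 0 ≤ ε * (1 + (Λ + 1) * r') := by positivity
        simp only [E]
        linarith
  have hK : 0 ≤ 1 + x + (Λ + 1) * t := by positivity
  have hlim : Tendsto (fun ε : ℝ => D t x + ε * (1 + x + (Λ + 1) * t)) (𝓝[>] 0) (𝓝 (D t x)) := by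
    have : ContinuousWithinAt (fun ε : ℝ => D t x + ε * (1 + x + (Λ + 1) * t)) (Set.Ioi 0) 0 := by
      fun_prop
    simpa [ContinuousWithinAt] using this
  exact ge_of_tendsto hlim (eventually_mem_nhdsWithin.mono key)

/-! ### The backward equation for bounded functions. -/

section BackwardEquation

lemma integrable_of_abs_le {m : Measure ℕ} [IsFiniteMeasure m] {f : ℕ → ℝ} {C : ℝ}
    (hf : ∀ y, |f y| ≤ C) : Integrable f m :=
  .of_bound (C := C) (by fun_prop) (.of_forall hf)

lemma abs_integral_le_of_abs_le {m : Measure ℕ} [IsProbabilityMeasure m] {f : ℕ → ℝ} {C : ℝ}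
    (hf : ∀ y, |f y| ≤ C) : |∫ y, f y ∂m| ≤ C := by
  simpa using norm_integral_le_of_norm_le_const (μ := m) (f := f) (C := C) (.of_forall hf)

lemma abs_integral_sub_sum_le {m : Measure ℕ} [IsProbabilityMeasure m] {f : ℕ → ℝ} {C : ℝ}
    (hf : ∀ y, |f y| ≤ C) (S : Finset ℕ) :
    |∫ y, f y ∂m - ∑ y ∈ S, m.real {y} * f y| ≤ C * (1 - ∑ y ∈ S, m.real {y}) := by
  have hint := integrable_of_abs_le (m := m) hf
  have h1 : ∫ y, f y ∂m - ∑ y ∈ S, m.real {y} * f y = ∫ y in (S : Set ℕ)ᶜ, f y ∂m := by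
    rw [← integral_add_compl S.measurableSet hint, setIntegral_finset S hint.integrableOn]
    simp
  have h2 : 1 - ∑ y ∈ S, m.real {y} = m.real (S : Set ℕ)ᶜ := by
    rw [probReal_compl_eq_one_sub S.measurableSet, sum_measureReal_singleton]
  rw [h1, h2]
  exact norm_setIntegral_le_of_norm_le_const (f := f) (measure_lt_top _ _) fun y _ => hf y

lemma exists_forall_le_of_isLittleO {g : ℝ≥0 → ℝ}
    (h : g =o[𝓝[>] 0] fun t : ℝ≥0 => (t : ℝ)) {ε : ℝ} (hε : 0 < ε) :
    ∃ δ : ℝ≥0, 0 < δ ∧ ∀ s : ℝ≥0, 0 < s → s < δ → |g s| ≤ ε * s := by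
  have h1 := h.def hε
  rw [eventually_iff, mem_nhdsGT_iff_exists_Ioo_subset] at h1
  obtain ⟨δ, hδ, hsub⟩ := h1
  refine ⟨δ, hδ, fun s hs hsδ => ?_⟩
  simpa using hsub ⟨hs, hsδ⟩

variable {lam nu : ℕ → ℝ} {P : ℝ≥0 → Kernel ℕ ℕ}

/-- The first-order expansion of the semigroup, uniform over bounded functions. -/
lemma IsTransitionSemigroup.expansion (hP : IsTransitionSemigroup lam nu P) (hnu0 : nu 0 = 0)
    (x : ℕ) {ε : ℝ} (hε : 0 < ε) :
    ∃ δ : ℝ≥0, 0 < δ ∧ ∀ s : ℝ≥0, 0 < s → s < δ → ∀ (f : ℕ → ℝ) (C : ℝ), (∀ y, |f y| ≤ C) →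
      |∫ y, f y ∂(P s x) - f x - s * generator lam nu f x| ≤ ε * C * s := by
  -- Six errors of size `ε / 6`: one for each of the three transition probabilities, and the same
  -- three again in the mass of the remaining sites.
  obtain ⟨δ₁, hδ₁, h₁⟩ := exists_forall_le_of_isLittleO (hP.birth x) (show 0 < ε / 6 by positivity)
  obtain ⟨δ₂, hδ₂, h₂⟩ := exists_forall_le_of_isLittleO (hP.stay x) (show 0 < ε / 6 by positivity)
  obtain ⟨δ₃, hδ₃, h₃⟩ := exists_forall_le_of_isLittleO (hP.death (x - 1))
    (show 0 < ε / 6 by positivity)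
  refine ⟨min δ₁ (min δ₂ δ₃), by positivity, fun s hs hsδ f C hf => ?_⟩
  have := hP.markov s
  simp only [lt_min_iff] at hsδ
  have b₁ := h₁ s hs hsδ.1
  have b₂ := h₂ s hs hsδ.2.1
  have b₃ := h₃ s hs hsδ.2.2
  have hC : 0 ≤ C := (abs_nonneg _).trans (hf 0)
  have mulle : ∀ e y, |e| ≤ ε / 6 * s → |e * f y| ≤ ε / 6 * s * C := fun e y he => by
    rw [abs_mul]; gcongr; exact hf y
  have c₁ := abs_le.1 (mulle _ (x + 1) b₁)
  have c₂ := abs_le.1 (mulle _ x b₂)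
  have c₃ := abs_le.1 (mulle _ (x - 1) b₃)
  rw [abs_le] at b₁ b₂ b₃ ⊢
  rcases x with _ | x
  · have h := abs_le.1 (abs_integral_sub_sum_le (m := P s 0) hf {0, 1})
    rw [Finset.sum_pair (by simp), Finset.sum_pair (by simp)] at h
    simp only [generator, hnu0, zero_add] at *
    have := mul_le_mul_of_nonneg_left (show 1 - ((P s 0).real {0} + (P s 0).real {1})
      ≤ 2 * (ε / 6 * s) by linarith) hC
    have : 0 ≤ ε / 6 * s * C := by positivity
    constructor <;> linarith
  · have h := abs_le.1 (abs_integral_sub_sum_le (m := P s (x + 1)) hf {x + 1, x + 1 + 1, x})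
    rw [Finset.sum_insert (by simp), Finset.sum_pair (by lia), Finset.sum_insert (by simp),
      Finset.sum_pair (by lia)] at h
    simp only [generator, Nat.add_sub_cancel] at *
    have := mul_le_mul_of_nonneg_left (show 1 - ((P s (x + 1)).real {x + 1} +
      ((P s (x + 1)).real {x + 1 + 1} + (P s (x + 1)).real {x}))
      ≤ 3 * (ε / 6 * s) by linarith) hC
    have : 0 ≤ ε / 6 * s * C := by positivity
    constructor <;> linarith

/-- The action `P_t f (x)` of a family of kernels on functions, with real time. -/
noncomputable def act (P : ℝ≥0 → Kernel ℕ ℕ) (f : ℕ → ℝ) (t : ℝ) (x : ℕ) : ℝ :=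
  ∫ y, f y ∂(P t.toNNReal x)

lemma abs_act_le (hP : IsTransitionSemigroup lam nu P) {f : ℕ → ℝ} {C : ℝ}
    (hf : ∀ y, |f y| ≤ C) (t : ℝ) (x : ℕ) : |act P f t x| ≤ C := by
  have := hP.markov t.toNNReal
  exact abs_integral_le_of_abs_le hf

lemma act_zero (hP : IsTransitionSemigroup lam nu P) (f : ℕ → ℝ) (x : ℕ) :
    act P f 0 x = f x := by
  simp [act, hP.zero, Kernel.id_apply]

lemma act_add (hP : IsTransitionSemigroup lam nu P) {f : ℕ → ℝ} {C : ℝ} (hf : ∀ y, |f y| ≤ C)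
    {t : ℝ} (ht : 0 ≤ t) (s : ℝ≥0) (x : ℕ) :
    act P f (t + s) x = ∫ y, act P f t y ∂(P s x) := by
  have := hP.markov s
  have := hP.markov t.toNNReal
  have := hP.markov (s + t.toNNReal)
  have h : (t + s).toNNReal = s + t.toNNReal := by
    rw [Real.toNNReal_add ht s.coe_nonneg, Real.toNNReal_coe, add_comm]
  have hint : Integrable f ((P t.toNNReal ∘ₖ P s) x) := by
    rw [← hP.chapman_kolmogorov]
    exact integrable_of_abs_le hf
  simp only [act]
  rw [h, hP.chapman_kolmogorov, Kernel.integral_comp hint]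

/-- The threshold `δ` does not depend on `t`, because `P_t f` obeys the same bound as `f`. This
uniformity is what later gives left continuity in time. -/
lemma act_expansion (hP : IsTransitionSemigroup lam nu P) (hnu0 : nu 0 = 0)
    (x : ℕ) {f : ℕ → ℝ} {C : ℝ} (hf : ∀ y, |f y| ≤ C) {ε : ℝ} (hε : 0 < ε) :
    ∃ δ : ℝ, 0 < δ ∧ ∀ t s : ℝ, 0 ≤ t → 0 < s → s < δ →
      |act P f (t + s) x - act P f t x - s * generator lam nu (act P f t) x| ≤ ε * s := by
  have hC : 0 ≤ C := (abs_nonneg _).trans (hf 0)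
  obtain ⟨δ, hδ, h⟩ := hP.expansion hnu0 x (show 0 < ε / (C + 1) by positivity)
  refine ⟨δ, hδ, fun t s ht hs hsδ => ?_⟩
  lift s to ℝ≥0 using hs.le
  rw [act_add hP hf ht]
  have := h s hs (by exact_mod_cast hsδ) (act P f t) C (abs_act_le hP hf t)
  refine this.trans ?_
  gcongr
  rw [div_mul_eq_mul_div, div_le_iff₀ (by positivity)]
  nlinarith

/-- The backward equation. -/
lemma hasDerivWithinAt_act (hP : IsTransitionSemigroup lam nu P) (hnu0 : nu 0 = 0)
    (x : ℕ) {f : ℕ → ℝ} {C : ℝ} (hf : ∀ y, |f y| ≤ C) {t : ℝ} (ht : 0 ≤ t) :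
    HasDerivWithinAt (fun t => act P f t x) (generator lam nu (act P f t) x) (Set.Ioi t) t := by
  rw [hasDerivWithinAt_iff_isLittleO, isLittleO_iff]
  intro ε hε
  obtain ⟨δ, hδ, h⟩ := act_expansion hP hnu0 x hf hε
  filter_upwards [Ioo_mem_nhdsGT (show t < t + δ by linarith)] with r hr
  have h1 : 0 < r - t := sub_pos.2 hr.1
  have := h t (r - t) ht h1 (by linarith [hr.2])
  rw [add_sub_cancel] at this
  simpa [abs_of_pos h1] using this

/-- A right derivative says nothing about left limits; the uniform expansion gives a Lipschitz bound
on intervals shorter than `δ`. -/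
lemma continuousOn_act (hP : IsTransitionSemigroup lam nu P) (hnu0 : nu 0 = 0)
    (x : ℕ) {f : ℕ → ℝ} {C : ℝ} (hf : ∀ y, |f y| ≤ C) :
    ContinuousOn (fun t => act P f t x) (Set.Ici 0) := by
  obtain ⟨δ, hδ, h⟩ := act_expansion hP hnu0 x hf one_pos
  set K : ℝ := 1 + (|lam x| * (C + C) + |nu x| * (C + C)) with hK
  have hC : 0 ≤ C := (abs_nonneg _).trans (hf 0)
  have hKpos : 0 < K := by positivity
  have hgen : ∀ t, |generator lam nu (act P f t) x| ≤ K - 1 := fun t => by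
    have hb := abs_act_le hP hf t
    rw [hK, add_sub_cancel_left]
    refine (abs_add_le _ _).trans (add_le_add ?_ ?_) <;> rw [abs_mul] <;> gcongr <;>
      exact (abs_sub _ _).trans (add_le_add (hb _) (hb _))
  have hlip : ∀ a b : ℝ, 0 ≤ a → a ≤ b → b < a + δ →
      |act P f b x - act P f a x| ≤ K * (b - a) := by
    intro a b ha hab hb
    rcases hab.eq_or_lt with rfl | hab
    · simp
    have hs : 0 < b - a := sub_pos.2 hab
    have h1 := h a (b - a) ha hs (by linarith)
    rw [add_sub_cancel] at h1
    have h2 : |(b - a) * generator lam nu (act P f a) x| ≤ (b - a) * (K - 1) := by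
      rw [abs_mul, abs_of_pos hs]; gcongr; exact hgen a
    have h3 := abs_add_le (act P f b x - act P f a x - (b - a) * generator lam nu (act P f a) x)
      ((b - a) * generator lam nu (act P f a) x)
    rw [sub_add_cancel] at h3
    linarith
  rw [Metric.continuousOn_iff]
  intro a ha ε hε
  refine ⟨min δ (ε / K), by positivity, fun b hb hab => ?_⟩
  rw [lt_min_iff, Real.dist_eq, lt_div_iff₀ hKpos] at hab
  rw [Real.dist_eq]
  rcases le_total a b with hle | hle
  · have h1 := hlip a b ha hle (by linarith [le_abs_self (b - a)])
    rw [abs_of_nonneg (sub_nonneg.2 hle)] at hab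
    linarith
  · have h1 := hlip b a hb hle (by linarith [neg_abs_le (b - a)])
    rw [abs_sub_comm, abs_of_nonneg (sub_nonneg.2 hle)] at hab
    rw [abs_sub_comm]
    linarith

end BackwardEquation

/-! ### Uniqueness, monotonicity and gradient contraction. -/

section Comparison

variable {lam nu : ℕ → ℝ} {P P' : ℝ≥0 → Kernel ℕ ℕ} {f h : ℕ → ℝ} {C C' : ℝ}

lemma act_le_act_of_bddAbove (hP : IsTransitionSemigroup lam nu P)
    (hP' : IsTransitionSemigroup lam nu P')
    (hlam : ∀ x, 0 ≤ lam x) (hnu : ∀ x, 0 ≤ nu x) (hnu0 : nu 0 = 0) {Λ : ℝ} (hΛ : ∀ x, lam x ≤ Λ)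
    (hf : ∀ y, |f y| ≤ C) {t : ℝ} (ht : 0 ≤ t) (x : ℕ) : act P f t x ≤ act P' f t x := by
  rw [← sub_nonneg]
  refine nonneg_of_supersolution (a := lam) (d := nu) (V := 0) (Λ := Λ) (C := C + C)
    (D := fun t x => act P' f t x - act P f t x) hlam hΛ hnu (fun _ => le_rfl) ?_ ?_ ?_ ?_ ht x
  · intro s _ y
    linarith [abs_le.1 (abs_act_le hP hf s y), abs_le.1 (abs_act_le hP' hf s y)]
  · simp [act_zero hP, act_zero hP']
  · exact fun y => (continuousOn_act hP' hnu0 y hf).sub (continuousOn_act hP hnu0 y hf)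
  · intro s hs y
    refine ⟨_, (hasDerivWithinAt_act hP' hnu0 y hf hs).sub
      (hasDerivWithinAt_act hP hnu0 y hf hs), le_of_eq ?_⟩
    simp only [generator, Pi.zero_apply]
    ring

/-- Uniqueness of the transition semigroup when the birth rates are bounded. -/
lemma act_unique (hP : IsTransitionSemigroup lam nu P) (hP' : IsTransitionSemigroup lam nu P')
    (hlam : ∀ x, 0 ≤ lam x) (hnu : ∀ x, 0 ≤ nu x) (hnu0 : nu 0 = 0) {Λ : ℝ} (hΛ : ∀ x, lam x ≤ Λ)
    (hf : ∀ y, |f y| ≤ C) {t : ℝ} (ht : 0 ≤ t) (x : ℕ) : act P f t x = act P' f t x :=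
  le_antisymm (act_le_act_of_bddAbove hP hP' hlam hnu hnu0 hΛ hf ht x)
    (act_le_act_of_bddAbove hP' hP hlam hnu hnu0 hΛ hf ht x)

/-- Commutation of the generator with the discrete derivative. -/
lemma generator_succ_sub_generator (hnu0 : nu 0 = 0) (u : ℕ → ℝ) (x : ℕ) :
    generator lam nu u (x + 1) - generator lam nu u x =
      generator (fun x => lam (x + 1)) nu (fun x => u (x + 1) - u x) x -
        ((nu (x + 1) - lam (x + 1)) - (nu x - lam x)) * (u (x + 1) - u x) := by
  rcases x with _ | x <;> simp only [generator, hnu0, Nat.add_sub_cancel] <;> ring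

lemma hasDerivWithinAt_act_succ_sub (hP : IsTransitionSemigroup lam nu P) (hnu0 : nu 0 = 0)
    (hf : ∀ y, |f y| ≤ C) (x : ℕ) {t : ℝ} (ht : 0 ≤ t) :
    HasDerivWithinAt (fun t => act P f t (x + 1) - act P f t x)
      (generator (fun x => lam (x + 1)) nu (fun x => act P f t (x + 1) - act P f t x) x -
        ((nu (x + 1) - lam (x + 1)) - (nu x - lam x)) * (act P f t (x + 1) - act P f t x))
      (Set.Ioi t) t := by
  rw [← generator_succ_sub_generator hnu0]
  exact (hasDerivWithinAt_act hP hnu0 (x + 1) hf ht).sub (hasDerivWithinAt_act hP hnu0 x hf ht)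

lemma continuousOn_act_succ_sub (hP : IsTransitionSemigroup lam nu P) (hnu0 : nu 0 = 0)
    (hf : ∀ y, |f y| ≤ C) (x : ℕ) :
    ContinuousOn (fun t => act P f t (x + 1) - act P f t x) (Set.Ici 0) :=
  (continuousOn_act hP hnu0 (x + 1) hf).sub (continuousOn_act hP hnu0 x hf)

/-- The semigroup preserves monotonicity. -/
lemma monotone_act (hP : IsTransitionSemigroup lam nu P) (hlam : ∀ x, 0 ≤ lam x)
    (hnu : ∀ x, 0 ≤ nu x) (hnu0 : nu 0 = 0) {Λ : ℝ} (hΛ : ∀ x, lam x ≤ Λ)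
    (hV : ∀ x, 0 ≤ (nu (x + 1) - lam (x + 1)) - (nu x - lam x))
    (hf : ∀ y, |f y| ≤ C) (hmono : Monotone f) {t : ℝ} (ht : 0 ≤ t) :
    Monotone (act P f t) := by
  refine monotone_nat_of_le_succ fun x => sub_nonneg.1 ?_
  refine nonneg_of_supersolution (a := fun x => lam (x + 1)) (d := nu) (Λ := Λ) (C := C + C)
    (D := fun t x => act P f t (x + 1) - act P f t x) (fun x => hlam (x + 1))
    (fun x => hΛ (x + 1)) hnu hV ?_ ?_ ?_ ?_ ht x
  · intro s _ y
    linarith [abs_le.1 (abs_act_le hP hf s y), abs_le.1 (abs_act_le hP hf s (y + 1))]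
  · intro y
    simpa [act_zero hP] using hmono y.le_succ
  · exact continuousOn_act_succ_sub hP hnu0 hf
  · exact fun s hs y => ⟨_, hasDerivWithinAt_act_succ_sub hP hnu0 hf y hs, le_rfl⟩

/-- Contraction of the discrete derivative along the semigroup. -/
lemma act_succ_sub_le (hP : IsTransitionSemigroup lam nu P) (hlam : ∀ x, 0 ≤ lam x)
    (hnu : ∀ x, 0 ≤ nu x) (hnu0 : nu 0 = 0) (hanti : Antitone lam) {κ : ℝ} (hκ0 : 0 ≤ κ)
    (hκ : ∀ x, κ ≤ (nu (x + 1) - lam (x + 1)) - (nu x - lam x))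
    (hf : ∀ y, |f y| ≤ C) (hh : ∀ y, |h y| ≤ C') (hmono : Monotone h) (hh0 : ∀ y, 0 ≤ h y)
    (hfh : ∀ x, f (x + 1) - f x ≤ h x) {t : ℝ} (ht : 0 ≤ t) (x : ℕ) :
    act P f t (x + 1) - act P f t x ≤ Real.exp (-(κ * t)) * act P h t x := by
  have hΛ : ∀ x, lam x ≤ lam 0 := fun x => hanti x.zero_le
  have hV : ∀ x, 0 ≤ (nu (x + 1) - lam (x + 1)) - (nu x - lam x) := fun x => hκ0.trans (hκ x)
  have hact0 : ∀ s y, 0 ≤ act P h s y := fun s y => integral_nonneg hh0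
  rw [← sub_nonneg]
  refine nonneg_of_supersolution (a := fun x => lam (x + 1)) (d := nu) (Λ := lam 0) (C := C + C)
    (D := fun t x => Real.exp (-(κ * t)) * act P h t x - (act P f t (x + 1) - act P f t x))
    (fun x => hlam (x + 1)) (fun x => hΛ (x + 1)) hnu hV ?_ ?_ ?_ ?_ ht x
  · intro s _ y
    have := mul_nonneg (Real.exp_pos (-(κ * s))).le (hact0 s y)
    linarith [abs_le.1 (abs_act_le hP hf s y), abs_le.1 (abs_act_le hP hf s (y + 1))]
  · intro y
    simpa [act_zero hP] using hfh y
  · intro y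
    exact ((by fun_prop : ContinuousOn (fun t => Real.exp (-(κ * t))) (Set.Ici 0)).mul
      (continuousOn_act hP hnu0 y hh)).sub (continuousOn_act_succ_sub hP hnu0 hf y)
  · intro s hs y
    have hexp : HasDerivWithinAt (fun t => Real.exp (-(κ * t))) (Real.exp (-(κ * s)) * -(κ * 1))
        (Set.Ioi s) s := ((hasDerivWithinAt_id s _).const_mul κ).neg.exp
    refine ⟨_, (hexp.mul (hasDerivWithinAt_act hP hnu0 y hh hs)).sub
      (hasDerivWithinAt_act_succ_sub hP hnu0 hf y hs), ?_⟩
    have hm : 0 ≤ act P h s (y + 1) - act P h s y :=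
      sub_nonneg.2 (monotone_act hP hlam hnu hnu0 hΛ hV hh hmono hs y.le_succ)
    have he := (Real.exp_pos (-(κ * s))).le
    -- The chain for the differences has birth rate `lam (y + 1)`, the one for `h` has `lam y`; the
    -- gap is favourable since `lam` decreases and `P_s h` increases.
    have h1 := mul_nonneg he (mul_nonneg (sub_nonneg.2 (hanti y.le_succ)) hm)
    have h2 := mul_nonneg he (mul_nonneg (sub_nonneg.2 (hκ y)) (hact0 s y))
    simp only [generator, Nat.succ_eq_add_one] at h1 h2 ⊢
    linarith

end Comparison

/-! ### From bounded functions to increasing convex ones. -/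

section Domination

variable {lam nu : ℕ → ℝ} {P P' : ℝ≥0 → Kernel ℕ ℕ} {f : ℕ → ℝ}

lemma IsTransitionSemigroup.unique (hP : IsTransitionSemigroup lam nu P)
    (hP' : IsTransitionSemigroup lam nu P')
    (hlam : ∀ x, 0 ≤ lam x) (hnu : ∀ x, 0 ≤ nu x) (hnu0 : nu 0 = 0) {Λ : ℝ} (hΛ : ∀ x, lam x ≤ Λ)
    (t : ℝ≥0) : P t = P' t := by
  have := hP.markov t
  have := hP'.markov t
  ext1 x
  refine Measure.ext_of_singleton fun z => ?_
  rw [← measureReal_eq_measureReal_iff]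
  have hf : ∀ y, |({z} : Set ℕ).indicator (1 : ℕ → ℝ) y| ≤ 1 := fun y => by
    by_cases h : y = z <;> simp [h]
  have h := act_unique hP hP' hlam hnu hnu0 hΛ hf t.coe_nonneg x
  simp only [act, Real.toNNReal_coe] at h
  rwa [integral_indicator_one (by simp), integral_indicator_one (by simp)] at h

lemma IsIncreasingConvex.monotone_diff (hf : IsIncreasingConvex f) :
    Monotone fun x => f (x + 1) - f x :=
  monotone_nat_of_le_succ fun x => sub_nonneg.1 (hf.convex x)

lemma IsIncreasingConvex.comp_add (hf : IsIncreasingConvex f) (k : ℕ) :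
    IsIncreasingConvex fun x => f (x + k) where
  nonneg x := hf.nonneg _
  mono _ _ hab := hf.mono (Nat.add_le_add_right hab k)
  convex x := by
    have := hf.convex (x + k)
    rwa [show x + k + 2 = x + 2 + k by ring, show x + k + 1 = x + 1 + k by ring] at this

/-- Truncation destroys the convexity of `f`, but the truncated increments remain monotone and still
dominate the increments of the truncated function. -/
lemma act_min_succ_sub_le (hP : IsTransitionSemigroup lam nu P) (hlam : ∀ x, 0 ≤ lam x)
    (hnu : ∀ x, 0 ≤ nu x) (hnu0 : nu 0 = 0) (hanti : Antitone lam) {κ : ℝ} (hκ0 : 0 ≤ κ)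
    (hκ : ∀ x, κ ≤ (nu (x + 1) - lam (x + 1)) - (nu x - lam x)) (hf : IsIncreasingConvex f)
    (N : ℕ) {t : ℝ} (ht : 0 ≤ t) (x : ℕ) :
    act P (fun y => f (min y N)) t (x + 1) - act P (fun y => f (min y N)) t x ≤
      Real.exp (-(κ * t)) * act P (fun y => f (min y N + 1) - f (min y N)) t x := by
  have hd : ∀ y, 0 ≤ f (y + 1) - f y := fun y => sub_nonneg.2 (hf.mono y.le_succ)
  refine act_succ_sub_le (C := f N) (C' := f (N + 1) - f N) hP hlam hnu hnu0 hanti hκ0 hκ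
    (fun y => ?_) (fun y => ?_) (fun a b hab => ?_) (fun y => hd _) (fun y => ?_) ht x
  · rw [abs_of_nonneg (hf.nonneg _)]
    exact hf.mono (min_le_right _ _)
  · rw [abs_of_nonneg (hd _)]
    exact hf.monotone_diff (min_le_right _ _)
  · exact hf.monotone_diff (min_le_min_right N hab)
  · rcases lt_or_ge y N with h | h
    · rw [min_eq_left h, min_eq_left h.le]
    · rw [min_eq_right h, min_eq_right (h.trans y.le_succ), sub_self]
      exact hd N

lemma lintegral_eq_iSup_lintegral_min (m : Measure ℕ) (hf : Monotone f) :
    ∫⁻ y, ENNReal.ofReal (f y) ∂m = ⨆ N : ℕ, ∫⁻ y, ENNReal.ofReal (f (min y N)) ∂m := by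
  rw [← lintegral_iSup (fun N => by fun_prop)
    fun a b hab y => ENNReal.ofReal_le_ofReal (hf (min_le_min_left y hab))]
  refine lintegral_congr fun y => le_antisymm ?_ ?_
  · exact le_iSup_of_le y (by rw [min_self])
  · exact iSup_le fun N => ENNReal.ofReal_le_ofReal (hf (min_le_left y N))

lemma ofReal_act {C : ℝ} (hP : IsTransitionSemigroup lam nu P) (hf0 : ∀ y, 0 ≤ f y)
    (hf : ∀ y, f y ≤ C) (t : ℝ≥0) (x : ℕ) :
    ENNReal.ofReal (act P f t x) = ∫⁻ y, ENNReal.ofReal (f y) ∂(P t x) := by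
  have := hP.markov t
  rw [act, Real.toNNReal_coe]
  exact ofReal_integral_eq_lintegral_ofReal (integrable_of_abs_le (C := C)
    fun y => by rw [abs_of_nonneg (hf0 y)]; exact hf y) (.of_forall hf0)

/-- One-step domination at the level of the semigroup. -/
lemma lintegral_succ_le (hP : IsTransitionSemigroup lam nu P) (hlam : ∀ x, 0 ≤ lam x)
    (hnu : ∀ x, 0 ≤ nu x) (hnu0 : nu 0 = 0) (hanti : Antitone lam) (κ : ℝ≥0)
    (hκ : ∀ x, (κ : ℝ) ≤ (nu (x + 1) - lam (x + 1)) - (nu x - lam x)) (hf : IsIncreasingConvex f)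
    (t : ℝ≥0) (x : ℕ) :
    ∫⁻ y, ENNReal.ofReal (f y) ∂(P t (x + 1)) ≤
      ENNReal.ofReal (expParam κ t) * ∫⁻ y, ENNReal.ofReal (f (y + 1)) ∂(P t x) +
        ENNReal.ofReal (1 - expParam κ t) * ∫⁻ y, ENNReal.ofReal (f y) ∂(P t x) := by
  set p : ℝ := (expParam κ t : ℝ)
  have hp0 : 0 ≤ p := (expParam κ t).2.1
  have hp1 : 0 ≤ 1 - p := sub_nonneg.2 (expParam κ t).2.2
  have hd : ∀ y, 0 ≤ f (y + 1) - f y := fun y => sub_nonneg.2 (hf.mono y.le_succ)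
  rw [lintegral_eq_iSup_lintegral_min (P t (x + 1)) hf.mono]
  refine iSup_le fun N => ?_
  have hfN : ∀ y, f (min y N) ≤ f N := fun y => hf.mono (min_le_right _ _)
  have hdN : ∀ y, f (min y N + 1) - f (min y N) ≤ f (N + 1) - f N := fun y =>
    hf.monotone_diff (min_le_right _ _)
  have h := act_min_succ_sub_le hP hlam hnu hnu0 hanti κ.coe_nonneg hκ hf N t.coe_nonneg x
  change _ ≤ p * _ at h
  rw [sub_le_iff_le_add] at h
  have h' := ENNReal.ofReal_le_ofReal h
  have hg0 : 0 ≤ act P (fun y => f (min y N + 1) - f (min y N)) t x :=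
    integral_nonneg fun y => hd _
  have hf0 : 0 ≤ act P (fun y => f (min y N)) t x := integral_nonneg fun y => hf.nonneg _
  rw [ofReal_act hP (fun y => hf.nonneg _) hfN,
    ENNReal.ofReal_add (mul_nonneg hp0 hg0) hf0, ENNReal.ofReal_mul hp0,
    ofReal_act hP (fun y => hf.nonneg _) hfN, ofReal_act hP (fun y => hd _) hdN] at h'
  -- With this splitting the right-hand side becomes `p ∫ (f (y + 1) - f y) + ∫ f`, with no
  -- subtraction in `[0, ∞]`.
  have hsplit : ∫⁻ y, ENNReal.ofReal (f (y + 1)) ∂(P t x) =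
      ∫⁻ y, ENNReal.ofReal (f (y + 1) - f y) ∂(P t x) + ∫⁻ y, ENNReal.ofReal (f y) ∂(P t x) := by
    rw [← lintegral_add_left (by fun_prop)]
    refine lintegral_congr fun y => ?_
    rw [← ENNReal.ofReal_add (hd y) (hf.nonneg y), sub_add_cancel]
  rw [hsplit, mul_add, add_assoc, ← add_mul, ← ENNReal.ofReal_add hp0 hp1, add_sub_cancel,
    ENNReal.ofReal_one, one_mul]
  refine h'.trans ?_
  refine add_le_add (mul_le_mul_right (lintegral_mono fun y => ?_) _)
    (lintegral_mono fun y => ?_)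
  · exact ENNReal.ofReal_le_ofReal (hf.monotone_diff (min_le_left y N))
  · exact ENNReal.ofReal_le_ofReal (hf.mono (min_le_left y N))

/-! ### Bernoulli and binomial laws, and the laws of the processes. -/

section Laws

lemma lintegral_bernoulliMeasure_nat (p : unitInterval) (g : ℕ → ℝ≥0∞) :
    ∫⁻ b, g b ∂(bernoulliMeasure 1 0 p) =
      ENNReal.ofReal p * g 1 + ENNReal.ofReal (1 - p) * g 0 := by
  have h1 : ENNReal.ofReal (p : ℝ) = (unitInterval.toNNReal p : ℝ≥0∞) :=
    ENNReal.ofReal_eq_coe_nnreal p.2.1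
  have h2 : ENNReal.ofReal (1 - (p : ℝ)) = (unitInterval.toNNReal (unitInterval.symm p) : ℝ≥0∞) :=
    ENNReal.ofReal_eq_coe_nnreal (unitInterval.symm p).2.1
  rw [bernoulliMeasure_def, lintegral_add_measure, h1, h2]
  simp only [lintegral_smul_measure, lintegral_dirac, ENNReal.smul_def, smul_eq_mul]

lemma binomial_succ (n : ℕ) (p : unitInterval) :
    binomial (n + 1) p = ENNReal.ofReal p • (binomial n p).map (· + 1) +
      ENNReal.ofReal (1 - p) • binomial n p := by
  have hp0 : 0 ≤ (p : ℝ) := p.2.1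
  have hp1 : 0 ≤ 1 - (p : ℝ) := sub_nonneg.2 p.2.2
  refine Measure.ext_of_singleton fun k => ?_
  rw [Measure.add_apply, Measure.smul_apply, Measure.smul_apply, smul_eq_mul, smul_eq_mul,
    Measure.map_apply (by fun_prop) (by simp)]
  rcases k with _ | k
  · have : (fun x : ℕ => x + 1) ⁻¹' {0} = ∅ := by ext; simp
    rw [this, measure_empty, mul_zero, zero_add, binomial_singleton, binomial_singleton,
      ← ENNReal.ofReal_mul hp1]
    congr 1
    simp [pow_succ, mul_comm]
  · have : (fun x : ℕ => x + 1) ⁻¹' {k + 1} = {k} := by ext; simp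
    rw [this, binomial_singleton, binomial_singleton, binomial_singleton, ← ENNReal.ofReal_mul hp0,
      ← ENNReal.ofReal_mul hp1, ← ENNReal.ofReal_add (by positivity) (by positivity)]
    congr 1
    rw [Nat.choose_succ_succ, Nat.add_sub_add_right]
    push_cast
    rcases lt_or_ge k n with h | h
    · obtain ⟨m, rfl⟩ := Nat.exists_eq_add_of_lt h
      rw [show k + m + 1 - k = m + 1 by lia, show k + m + 1 - (k + 1) = m by lia]
      ring
    · rw [Nat.choose_eq_zero_of_lt (show n < k + 1 by lia)]
      push_cast
      ring

lemma lintegral_binomial_succ (n : ℕ) (p : unitInterval) (g : ℕ → ℝ≥0∞) :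
    ∫⁻ b, g b ∂(binomial (n + 1) p) = ENNReal.ofReal p * ∫⁻ b, g (b + 1) ∂(binomial n p) +
      ENNReal.ofReal (1 - p) * ∫⁻ b, g b ∂(binomial n p) := by
  rw [binomial_succ, lintegral_add_measure, lintegral_smul_measure, lintegral_smul_measure,
    lintegral_map (by fun_prop) (by fun_prop), smul_eq_mul, smul_eq_mul]

lemma lintegral_binomial_zero (p : unitInterval) (g : ℕ → ℝ≥0∞) :
    ∫⁻ b, g b ∂(binomial 0 p) = g 0 := by
  have : binomial 0 p = Measure.dirac 0 := by
    refine Measure.ext_of_singleton fun k => ?_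
    rw [binomial_singleton]
    rcases k with _ | k <;> simp
  rw [this, lintegral_dirac]

/-- Domination by a binomial shift at the level of the semigroup. -/
lemma lintegral_le_lintegral_binomial (hP : IsTransitionSemigroup lam nu P)
    (hlam : ∀ x, 0 ≤ lam x) (hnu : ∀ x, 0 ≤ nu x) (hnu0 : nu 0 = 0) (hanti : Antitone lam)
    (κ : ℝ≥0) (hκ : ∀ x, (κ : ℝ) ≤ (nu (x + 1) - lam (x + 1)) - (nu x - lam x))
    (t : ℝ≥0) (x : ℕ) (hf : IsIncreasingConvex f) :
    ∫⁻ y, ENNReal.ofReal (f y) ∂(P t x) ≤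
      ∫⁻ b, ∫⁻ y, ENNReal.ofReal (f (y + b)) ∂(P t 0) ∂(binomial x (expParam κ t)) := by
  induction x generalizing f with
  | zero => simp [lintegral_binomial_zero]
  | succ x ih =>
    refine (lintegral_succ_le hP hlam hnu hnu0 hanti κ hκ hf t x).trans ?_
    rw [lintegral_binomial_succ]
    refine add_le_add (mul_le_mul_right ?_ _) (mul_le_mul_right (ih hf) _)
    -- A successful trial is absorbed into a shift of `f`, hence the induction over all `f`.
    refine (ih (hf.comp_add 1)).trans_eq ?_
    simp only [add_assoc]

variable {Ω : Type*} [MeasurableSpace Ω] {μ : Measure Ω} [IsProbabilityMeasure μ]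

/-- Integrate the Markov property at time `0`, where the process is almost surely at `y`. -/
lemma IsBirthDeathProcess.exists_map_eq {y : ℕ} {X : ℝ≥0 → Ω → ℕ}
    (hX : IsBirthDeathProcess lam nu y X μ) :
    ∃ P, IsTransitionSemigroup lam nu P ∧ ∀ t, μ.map (X t) = P t y := by
  obtain ⟨P, hP, hmarkov⟩ := hX.markov_property
  refine ⟨P, hP, fun t => Measure.ext_of_singleton fun z => ?_⟩
  have := hP.markov t
  have hm := hX.measurable
  have hle : past X 0 ≤ ‹MeasurableSpace Ω› := iSup₂_le fun u _ => (hm u).comap_le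
  have h := hmarkov 0 t z
  rw [zero_add] at h
  have h1 : μ.real (X t ⁻¹' {z}) = ∫ ω, (P t (X 0 ω)).real {z} ∂μ := by
    rw [← integral_congr_ae h, integral_condExp hle,
      integral_indicator (hm t (measurableSet_singleton z))]
    simp
  have h2 : ∫ ω, (P t (X 0 ω)).real {z} ∂μ = (P t y).real {z} := by
    rw [integral_congr_ae (g := fun _ => (P t y).real {z})
      (hX.start.mono fun ω hω => by simp only [hω])]
    simp
  rw [Measure.map_apply (hm t) (measurableSet_singleton z), ← measureReal_eq_measureReal_iff, h1,
    h2]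

lemma lintegral_add_of_indepFun {X Y : Ω → ℕ} {ρ : Measure ℕ} [SFinite ρ] (hX : Measurable X)
    (hY : HasLaw Y ρ μ) (hXY : IndepFun X Y μ) (g : ℕ → ℝ≥0∞) :
    ∫⁻ ω, g (X ω + Y ω) ∂μ = ∫⁻ b, ∫⁻ a, g (a + b) ∂(μ.map X) ∂ρ := by
  have h := (indepFun_iff_map_prod_eq_prod_map_map hX.aemeasurable hY.aemeasurable).1 hXY
  rw [hY.map_eq] at h
  have hg : Measurable fun q : ℕ × ℕ => g (q.1 + q.2) := by fun_prop
  rw [← lintegral_map' (f := fun q : ℕ × ℕ => g (q.1 + q.2)) (g := fun ω => (X ω, Y ω))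
    hg.aemeasurable (hX.aemeasurable.prodMk hY.aemeasurable), h,
    lintegral_prod_symm _ hg.aemeasurable]

end Laws

end Domination

end BirthDeath

open BirthDeath in
theorem mainTheorem8 {Ω Ω' : Type*} [MeasurableSpace Ω] [MeasurableSpace Ω']
    (μ : Measure Ω) [IsProbabilityMeasure μ] (μ' : Measure Ω') [IsProbabilityMeasure μ']
    (X : ℝ≥0 → Ω → ℕ) (X' : ℝ≥0 → Ω' → ℕ)
    (lam nu : ℕ → ℝ) (hlam : ∀ x, 0 ≤ lam x) (hnu : ∀ x, 0 ≤ nu x) (hnu0 : nu 0 = 0)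
    (κ : ℝ≥0) (hanti : Antitone lam)
    (hκ : ∀ x, (κ : ℝ) ≤ (nu (x + 1) - lam (x + 1)) - (nu x - lam x))
    (t : ℝ≥0) (x : ℕ) :
    (BirthDeath.IsBirthDeathProcess lam nu (x + 1) X' μ' →
      BirthDeath.IsBirthDeathProcess lam nu x X μ →
      ∀ Y : Ω → ℕ, HasLaw Y (bernoulliMeasure 1 0 (BirthDeath.expParam κ t)) μ →
        IndepFun (X t) Y μ →
        BirthDeath.ConvexDominated (X' t) μ' (fun ω => X t ω + Y ω) μ) ∧
    (BirthDeath.IsBirthDeathProcess lam nu x X' μ' →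
      BirthDeath.IsBirthDeathProcess lam nu 0 X μ →
      ∀ B : Ω → ℕ, HasLaw B (binomial x (BirthDeath.expParam κ t)) μ →
        IndepFun (X t) B μ →
        BirthDeath.ConvexDominated (X' t) μ' (fun ω => X t ω + B ω) μ) := by
  have hΛ : ∀ x, lam x ≤ lam 0 := fun x => hanti x.zero_le
  refine ⟨fun hX' hX Y hY hXY f hf => ?_, fun hX' hX B hB hXB f hf => ?_⟩
  all_goals
    obtain ⟨P, hP, hmap⟩ := hX.exists_map_eq
    obtain ⟨P', hP', hmap'⟩ := hX'.exists_map_eq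
    -- Each process brings its own semigroup; uniqueness, available because `lam` is bounded by `lam
    -- 0`, identifies them.
    rw [← lintegral_map (f := fun y => ENNReal.ofReal (f y)) (by fun_prop) (hX'.measurable t),
      hmap', hP'.unique hP hlam hnu hnu0 hΛ]
  · rw [lintegral_add_of_indepFun (hX.measurable t) hY hXY fun y => ENNReal.ofReal (f y), hmap,
      lintegral_bernoulliMeasure_nat]
    exact lintegral_succ_le hP hlam hnu hnu0 hanti κ hκ hf t x
  · rw [lintegral_add_of_indepFun (hX.measurable t) hB hXB fun y => ENNReal.ofReal (f y), hmap]
    exact lintegral_le_lintegral_binomial hP hlam hnu hnu0 hanti κ hκ t x hf
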